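/- Let $d,m\ge 0$ and $n\ge 1$ be integers, let $E\subseteq\{1,\dots,n\}\times\{1,\dots,m\}$, and for $(k,i)\in E$ let $x_{k,i}\in\mathbb{R}^d$ be the local coordinates of the $k$-th point in the $i$-th view. Let $\Gamma$ be the bipartite graph on the $n$ points and $m$ views with edge set $E$. Assume that $\Gamma$ is connected and that every view is affinely non-degenerate, i.e. for every $i$ the points $\{x_{k,i}:(k,i)\in E\}$ affinely span $\mathbb{R}^d$. *Alignment error.* With $e_{ki}=e_k-e_{n+i}\in\mathbb{R}^{n+m}$ put $\mathcal{L}_\Gamma=\sum_{(k,i)\in E}e_{ki}e_{ki}^T$, let $D$ be the block diagonal matrix with $i$-th block $\sum_{k:(k,i)\in E}x_{k,i}x_{k,i}^T$, let $B$ be the matrix with $i$-th row block $\sum_{k:(k,i)\in E}x_{k,i}e_{ki}^T$, and let $C=D-B\mathcal{L}_\Gamma^\dagger B^T$, where $\dagger$ is the Moore–Penrose inverse. For $S=[S_i]_1^m\in\mathbb{O}(d)^m$ (stacked as an $md\times d$ matrix) put $F(S)=\mathrm{Tr}(CSS^T)$. Let $\pi:\mathbb{O}(d)^m\to\mathbb{O}(d)^m/{\sim}$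 be the quotient by the right action $S\mapsto SQ$ of $\mathbb{O}(d)$, with the Riemannian metric induced from $g(Z,W)=\mathrm{Tr}(Z^TW)$, and let $\widetilde F$ be the function induced by $F$ on the quotient. A non-degenerate minimum of $\widetilde F$ is a minimum at which the Riemannian Hessian of $\widetilde F$ is non-singular. $S$ is a perfect alignment if $F(S)=0$. *Certificates.* Let $L(S)=C(S)-\widehat C(S)$, where $C(S)$ has blocks $C(S)_{ij}=S_i^TC_{ij}S_j$ and $\widehat C(S)$ is block diagonal with blocks $\widehat C(S)_{ii}=\sum_j S_i^TC_{ij}S_j$. A certificate of $L(S)$ is $\Omega=[\Omega_i]_1^m$ with all $\Omega_i$ skew-symmetric $d\times d$ matrices and $L(S)\Omega=0$; it is trivial if all the $\Omega_i$ are equal. *Realization.* Let $\Theta(S)=S^TB\mathcal{L}_\Gamma^\dagger(:,1{:}n)\,(I_n-n^{-1}\mathbf{1}_n\mathbf{1}_n^T)$, with columns $x_k(S)\in\mathbb{R}^d$, $1\le k\le n$. It is infinitesimally rigid (with respect to the within-view distance constraints) if every $(p_k)_1^n$ in $\mathbb{R}^d$ with $(p_{k_1}-p_{k_2})^T(x_{k_1}(S)-x_{k_2}(S))=0$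 for all $(k_1,i),(k_2,i)\in E$ is trivial, i.e. $p_k=\Omega x_k(S)+t$ for all $k$, for some skew-symmetric $\Omega$ and some $t\in\mathbb{R}^d$. **Theorem.** Let $S\in\mathbb{O}(d)^m$ be a perfect alignment. Then the following are equivalent: (1) $\pi(S)$ is a non-degenerate minimum of $\widetilde F$; (2) every certificate of $L(S)$ is trivial; (3) $\Theta(S)$ is infinitesimally rigid. -/

import Mathlib

open Matrix

noncomputable section

namespace RigidAlign

/-! ### Moore–Penrose inverse of a real symmetric matrix -/

/-- The four Penrose equations for real matrices. -/
structure IsMoorePenroseInverse {ι κ : Type*} [Fintype ι] [Fintype κ]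
    (A : Matrix ι κ ℝ) (P : Matrix κ ι ℝ) : Prop where
  mul_mul_self : A * P * A = A
  mul_mul_inv : P * A * P = P
  symm_left : (A * P)ᵀ = A * P
  symm_right : (P * A)ᵀ = P * A

theorem IsMoorePenroseInverse.unique {ι κ : Type*} [Fintype ι] [Fintype κ]
    {A : Matrix ι κ ℝ} {P Q : Matrix κ ι ℝ}
    (hP : IsMoorePenroseInverse A P) (hQ : IsMoorePenroseInverse A Q) : P = Q := by
  have h1 : A * P = A * Q := by
    calc A * P = (A * P)ᵀ := hP.symm_left.symm
      _ = ((A * Q * A) * P)ᵀ := by rw [hQ.mul_mul_self]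
      _ = ((A * Q) * (A * P))ᵀ := by rw [Matrix.mul_assoc (A * Q)]
      _ = (A * P) * (A * Q) := by rw [transpose_mul, hP.symm_left, hQ.symm_left]
      _ = A * P * A * Q := by simp only [Matrix.mul_assoc]
      _ = A * Q := by rw [hP.mul_mul_self]
  have h2 : P * A = Q * A := by
    calc P * A = (P * A)ᵀ := hP.symm_right.symm
      _ = (P * (A * Q * A))ᵀ := by rw [hQ.mul_mul_self]
      _ = ((P * A) * (Q * A))ᵀ := by simp only [Matrix.mul_assoc]
      _ = (Q * A) * (P * A) := by rw [transpose_mul, hP.symm_right, hQ.symm_right]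
      _ = Q * (A * P * A) := by simp only [Matrix.mul_assoc]
      _ = Q * A := by rw [hP.mul_mul_self]
  calc P = P * A * P := hP.mul_mul_inv.symm
    _ = Q * (A * P) := by rw [h2, Matrix.mul_assoc]
    _ = Q * A * Q := by rw [h1, Matrix.mul_assoc]
    _ = Q := hQ.mul_mul_inv

theorem exists_moorePenroseInverse {ι : Type*} [Fintype ι] [DecidableEq ι]
    {A : Matrix ι ι ℝ} (hA : Aᵀ = A) : ∃ P, IsMoorePenroseInverse A P := by
  have hH : A.IsHermitian := by
    rw [Matrix.IsHermitian, conjTranspose_eq_transpose_of_trivial, hA]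
  obtain ⟨U, D, hU, hAU⟩ : ∃ (U : Matrix ι ι ℝ) (D : ι → ℝ), Uᵀ * U = 1 ∧
      A = U * diagonal D * Uᵀ := by
    refine ⟨hH.eigenvectorUnitary, hH.eigenvalues, ?_, ?_⟩
    · have := (Matrix.mem_unitaryGroup_iff').1 hH.eigenvectorUnitary.2
      simpa [star_eq_conjTranspose, conjTranspose_eq_transpose_of_trivial] using this
    · have := hH.spectral_theorem
      rw [Unitary.conjStarAlgAut_apply] at this
      simpa [star_eq_conjTranspose, conjTranspose_eq_transpose_of_trivial,
        Function.comp_def] using this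
  have key : ∀ d e : ι → ℝ, (U * diagonal d * Uᵀ) * (U * diagonal e * Uᵀ)
      = U * diagonal (d * e) * Uᵀ := by
    intro d e
    calc (U * diagonal d * Uᵀ) * (U * diagonal e * Uᵀ)
        = U * diagonal d * (Uᵀ * U) * diagonal e * Uᵀ := by simp only [Matrix.mul_assoc]
      _ = U * (diagonal d * diagonal e) * Uᵀ := by
          rw [hU]; simp only [Matrix.mul_assoc, Matrix.mul_one]
      _ = _ := by rw [diagonal_mul_diagonal]; rfl
  have ht : ∀ d : ι → ℝ, (U * diagonal d * Uᵀ)ᵀ = U * diagonal d * Uᵀ := by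
    intro d
    simp [transpose_mul, Matrix.mul_assoc]
  refine ⟨U * diagonal D⁻¹ * Uᵀ, ?_, ?_, ?_, ?_⟩
  · rw [hAU, key, key]
    congr 3; funext i; by_cases h : D i = 0 <;> simp [h]
  · rw [hAU, key, key]
    congr 3; funext i; by_cases h : D i = 0 <;> simp [h]
  · rw [hAU, key, ht]
  · rw [hAU, key, ht]

/-! ### Views, correspondence graph and alignment error -/

/-- `n` points, `m` views in `ℝ^d`: `(k, i) ∈ E` means that the `k`-th point lies in the `i`-th
view, and then `x k i` are its local coordinates in that view (values of `x` outside `E` are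
never used). -/
structure ViewSystem (d n m : ℕ) where
  E : Finset (Fin n × Fin m)
  x : Fin n → Fin m → Fin d → ℝ

/-- Vertical stack of `m` square matrices of size `d`; the row `(a, i)` is the `a`-th row of the
`i`-th block. -/
abbrev Stack (d m : ℕ) := Matrix (Fin d × Fin m) (Fin d) ℝ

/-- The `i`-th block of a stack. -/
def blk {d m : ℕ} (S : Stack d m) (i : Fin m) : Matrix (Fin d) (Fin d) ℝ :=
  Matrix.of fun a b => S (a, i) b

/-- The stack with given blocks. -/
def stack {d m : ℕ} (Z : Fin m → Matrix (Fin d) (Fin d) ℝ) : Stack d m :=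
  Matrix.of fun r b => Z r.2 r.1 b

/-- The manifold `𝕆(d)^m` of stacks of orthogonal matrices. -/
abbrev OrthStack (d m : ℕ) :=
  {S : Stack d m // ∀ i, blk S i ∈ Matrix.orthogonalGroup (Fin d) ℝ}

namespace ViewSystem

variable {d n m : ℕ} (V : ViewSystem d n m)

/-- The bipartite correspondence graph `Γ` between points and views. -/
def graph : SimpleGraph (Fin n ⊕ Fin m) :=
  SimpleGraph.fromRel fun v w => ∃ k i, (k, i) ∈ V.E ∧ v = Sum.inl k ∧ w = Sum.inr i

/-- The set of local coordinates of the points of the `i`-th view. -/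
def viewPoints (i : Fin m) : Set (Fin d → ℝ) := {y | ∃ k, (k, i) ∈ V.E ∧ y = V.x k i}

/-- Every view is affinely non-degenerate: its points affinely span `ℝ^d`. -/
def AffinelyNondegenerate : Prop := ∀ i, affineSpan ℝ (V.viewPoints i) = ⊤

/-- The vector `e_{ki}`: `1` at the point `k`, `-1` at the view `i`, and `0` elsewhere. -/
def edgeVec (p : Fin n × Fin m) : Fin n ⊕ Fin m → ℝ :=
  Pi.single (Sum.inl p.1) 1 - Pi.single (Sum.inr p.2) 1

/-- The combinatorial Laplacian of `Γ`. -/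
def laplacian : Matrix (Fin n ⊕ Fin m) (Fin n ⊕ Fin m) ℝ :=
  ∑ p ∈ V.E, vecMulVec (edgeVec p) (edgeVec p)

theorem laplacian_transpose : V.laplacianᵀ = V.laplacian := by
  simp [laplacian, transpose_sum, transpose_vecMulVec]

/-- The Moore–Penrose inverse of the Laplacian. -/
def laplacianPinv : Matrix (Fin n ⊕ Fin m) (Fin n ⊕ Fin m) ℝ :=
  (exists_moorePenroseInverse V.laplacian_transpose).choose

theorem laplacianPinv_spec : IsMoorePenroseInverse V.laplacian V.laplacianPinv :=
  (exists_moorePenroseInverse V.laplacian_transpose).choose_spec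

/-- The block diagonal matrix whose `i`-th block is the sum of `x_{k,i} x_{k,i}ᵀ` over the points
`k` of the view `i`. -/
def matD : Matrix (Fin d × Fin m) (Fin d × Fin m) ℝ :=
  blockDiagonal fun i => ∑ p ∈ V.E with p.2 = i, vecMulVec (V.x p.1 p.2) (V.x p.1 p.2)

/-- The matrix whose `i`-th row block is the sum of `x_{k,i} e_{ki}ᵀ` over the points `k` of the
view `i`. -/
def matB : Matrix (Fin d × Fin m) (Fin n ⊕ Fin m) ℝ :=
  Matrix.of fun r v => ∑ p ∈ V.E with p.2 = r.2, V.x p.1 p.2 r.1 * edgeVec p v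

/-- The matrix `C = D - B L_Γ^† Bᵀ`. -/
def matC : Matrix (Fin d × Fin m) (Fin d × Fin m) ℝ :=
  V.matD - V.matB * V.laplacianPinv * V.matBᵀ

/-- The alignment error `F(S) = Tr(C S Sᵀ)`, i.e. the minimum over the translations `t_i` and the
consensus points `x_k` of the sum over `(k, i) ∈ E` of `‖S_iᵀ x_{k,i} + t_i - x_k‖²`. -/
def F (S : Stack d m) : ℝ := (V.matC * S * Sᵀ).trace

/-- A perfect alignment has zero alignment error. -/
def IsPerfectAlignment (S : OrthStack d m) : Prop := V.F S.1 = 0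

/-- The realization `Θ(S)` of the points due to the alignment `S`, centered at the origin:
`Sᵀ B L_Γ^†(:, 1:n) (I_n - n⁻¹ 1 1ᵀ)`. Its `k`-th column is the position of the `k`-th point. -/
def realization (S : Stack d m) : Matrix (Fin d) (Fin n) ℝ :=
  (Sᵀ * V.matB * V.laplacianPinv).submatrix id Sum.inl *
    (1 - (n : ℝ)⁻¹ • Matrix.of fun _ _ => (1 : ℝ))

/-! ### Infinitesimal rigidity -/

/-- The points `X_1, …, X_n ∈ ℝ^d` (columns of `X`) are infinitesimally rigid with respect to the
distance constraints within the views: every perturbation preserving, to first order, the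
distance between any two points that share a view is trivial, i.e. is an infinitesimal rigid
motion `X_k ↦ Ω X_k + t` with `Ω` skew-symmetric. -/
def IsInfinitesimallyRigid (X : Matrix (Fin d) (Fin n) ℝ) : Prop :=
  ∀ p : Fin n → Fin d → ℝ,
    (∀ k₁ k₂ i, (k₁, i) ∈ V.E → (k₂, i) ∈ V.E → (p k₁ - p k₂) ⬝ᵥ (X.col k₁ - X.col k₂) = 0) →
    ∃ (Ω : Matrix (Fin d) (Fin d) ℝ) (t : Fin d → ℝ), Ωᵀ = -Ω ∧ ∀ k, p k = Ω *ᵥ X.col k + t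

/-! ### Certificates -/

/-- `C(S)`, with blocks `S_iᵀ C_{ij} S_j`. -/
def matCS (S : Stack d m) : Matrix (Fin d × Fin m) (Fin d × Fin m) ℝ :=
  blockDiagonal (fun i => (blk S i)ᵀ) * V.matC * blockDiagonal (fun i => blk S i)

/-- `Ĉ(S)`, block diagonal with `i`-th block `S_iᵀ [C S]_i`, the sum over `j` of
`S_iᵀ C_{ij} S_j`. -/
def matCHat (S : Stack d m) : Matrix (Fin d × Fin m) (Fin d × Fin m) ℝ :=
  blockDiagonal fun i => (blk S i)ᵀ * blk (V.matC * S) i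

/-- `L(S) = C(S) - Ĉ(S)`. -/
def matL (S : Stack d m) : Matrix (Fin d × Fin m) (Fin d × Fin m) ℝ :=
  V.matCS S - V.matCHat S

/-- A certificate of `L(S)`: a stack of skew-symmetric matrices in the kernel of `L(S)`. -/
def IsCertificate (S Ω : Stack d m) : Prop :=
  (∀ i, (blk Ω i)ᵀ = -blk Ω i) ∧ V.matL S * Ω = 0

/-- Every certificate of `L(S)` is trivial, i.e. has all its blocks equal. -/
def HasOnlyTrivialCertificates (S : Stack d m) : Prop :=
  ∀ Ω, V.IsCertificate S Ω → ∀ i j, blk Ω i = blk Ω j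

end ViewSystem

/-! ### The quotient of `𝕆(d)^m` by the right action of `𝕆(d)` -/

/-- `S ∼ T` iff `T = S Q` for some orthogonal `Q`. -/
def orthSetoid (d m : ℕ) : Setoid (OrthStack d m) where
  r S T := ∃ Q ∈ Matrix.orthogonalGroup (Fin d) ℝ, T.1 = S.1 * Q
  iseqv := by
    refine ⟨fun S => ⟨1, one_mem _, by simp⟩, ?_, ?_⟩
    · rintro S T ⟨Q, hQ, h⟩
      have h1 : Q * Qᵀ = 1 := (Matrix.mem_orthogonalGroup_iff (Fin d) ℝ).1 hQ
      have h2 : Qᵀ * Q = 1 := (Matrix.mem_orthogonalGroup_iff' (Fin d) ℝ).1 hQ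
      refine ⟨Qᵀ, (Matrix.mem_orthogonalGroup_iff (Fin d) ℝ).2 ?_, ?_⟩
      · rw [transpose_transpose, h2]
      · rw [h, Matrix.mul_assoc, h1, Matrix.mul_one]
    · rintro S T U ⟨Q, hQ, h⟩ ⟨R, hR, h'⟩
      exact ⟨Q * R, mul_mem hQ hR, by rw [h', h, Matrix.mul_assoc]⟩

/-- The quotient `𝕆(d)^m/∼`. -/
abbrev AlignmentSpace (d m : ℕ) := Quotient (orthSetoid d m)

/-- The quotient map `π`. -/
def proj {d m : ℕ} (S : OrthStack d m) : AlignmentSpace d m := Quotient.mk (orthSetoid d m) S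

/-- The tangent space `T_S 𝕆(d)^m`. -/
def IsTangent {d m : ℕ} (S Z : Stack d m) : Prop :=
  ∀ i, (blk S i)ᵀ * blk Z i + (blk Z i)ᵀ * blk S i = 0

/-- The metric `g(Z, W) = Tr(Zᵀ W)`. -/
def metric {d m : ℕ} (Z W : Stack d m) : ℝ := (Zᵀ * W).trace

/-- The horizontal space `H_S`: the tangent vectors at `S` orthogonal to the vertical space
`V_S = {S Ω : Ω skew-symmetric}`, which is tangent to the fibre of `π` through `S`. The
differential of `π` identifies `H_S` isometrically with the tangent space of the quotient
at `π(S)`. -/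
def IsHorizontal {d m : ℕ} (S Z : Stack d m) : Prop :=
  IsTangent S Z ∧ ∀ Ω : Matrix (Fin d) (Fin d) ℝ, Ωᵀ = -Ω → metric (S * Ω) Z = 0

/-- The skew-symmetric part of a matrix. -/
def skewPart {d : ℕ} (A : Matrix (Fin d) (Fin d) ℝ) : Matrix (Fin d) (Fin d) ℝ :=
  (2⁻¹ : ℝ) • (A - Aᵀ)

/-- The orthogonal projection `P_S` onto `T_S 𝕆(d)^m`, with blocks `S_i Skew(S_iᵀ X_i)`. -/
def tangentProj {d m : ℕ} (S X : Stack d m) : Stack d m :=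
  stack fun i => blk S i * skewPart ((blk S i)ᵀ * blk X i)

namespace ViewSystem

variable {d n m : ℕ} (V : ViewSystem d n m)

/-- `F` is invariant under the right action of `𝕆(d)`, so it descends to the quotient as `F̃`. -/
def Ftilde : AlignmentSpace d m → ℝ :=
  Quotient.lift (s := orthSetoid d m) (fun S => V.F S.1) (by
    rintro S T ⟨Q, hQ, h⟩
    have hQ' : Q * Qᵀ = 1 := (Matrix.mem_orthogonalGroup_iff (Fin d) ℝ).1 hQ
    have : S.1 * S.1ᵀ = T.1 * T.1ᵀ := by
      rw [h, transpose_mul, Matrix.mul_assoc, ← Matrix.mul_assoc Q, hQ', Matrix.one_mul]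
    simp only [F, Matrix.mul_assoc, this])

/-- The Euclidean gradient `∇F(S)` (matrix of partial derivatives). -/
def euclideanGrad (S : Stack d m) : Stack d m :=
  Matrix.of fun r c => deriv (fun t : ℝ => V.F (S + t • Matrix.single r c 1)) 0

/-- The Riemannian gradient of `F` on `𝕆(d)^m`, `grad F(S) = P_S(∇F(S))`, given by a formula that
makes sense on all stacks. -/
def riemannianGrad (S : Stack d m) : Stack d m := tangentProj S (V.euclideanGrad S)

/-- The directional derivative `D grad F(S)[Z]`. -/
def derivRiemannianGrad (S Z : Stack d m) : Stack d m :=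
  Matrix.of fun r c => deriv (fun t : ℝ => V.riemannianGrad (S + t • Z) r c) 0

/-- The Riemannian Hessian form of `F̃` at `π(S)` on horizontal lifts `Z, W ∈ H_S` of tangent
vectors `Z̃, W̃`: the horizontal lift of `Hess F̃[Z̃]` is the horizontal projection
of `∇_Z grad F = P_S(D grad F(S)[Z])`, so, as `W` is tangent and horizontal,
`g̃(Hess F̃[Z̃], W̃) = g(D grad F(S)[Z], W)`. -/
def hessForm (S Z W : Stack d m) : ℝ := metric (V.derivRiemannianGrad S Z) W

/-- `q` is a non-degenerate minimum of `F̃`: a minimum where the Riemannian Hessian of `F̃` is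
non-singular. The condition is imposed through all representatives `S` of `q`. -/
def IsNondegenerateMin (q : AlignmentSpace d m) : Prop :=
  (∀ q', V.Ftilde q ≤ V.Ftilde q') ∧
  ∀ S : OrthStack d m, proj S = q →
    ∀ Z, IsHorizontal S.1 Z → (∀ W, IsHorizontal S.1 W → V.hessForm S.1 Z W = 0) → Z = 0

end ViewSystem

end RigidAlign

end

/-!
The rows of the edge-vertex incidence matrix `J` of `Γ` are the vectors `e_{ki}ᵀ`; let `K` be the
matrix whose row at the edge `(k, i)` is `x_{k,i}ᵀ` placed in the block `i`. Then `L_Γ = Jᵀ J`,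
`B = Kᵀ J`, `D = Kᵀ K`, and hence `C = Wᵀ W` for the residual matrix `W = K - J L_Γ^† Bᵀ`
(`matC_eq`). So `F ≥ 0`, `F(S) = 0` is the same as `C S = 0`, and for every stack `Z`

  `C Z = 0` if and only if there are vectors `y_k`, `t_i` with `Z_iᵀ x_{k,i} = y_k - t_i` for all
  `(k, i) ∈ E` (`matC_mul_eq_zero_iff_exists`).

At a perfect alignment everything is governed by the tangent vectors in the kernel of `C`. As
`C S = 0`, the term `Ĉ(S)` vanishes, and `Ω` is a certificate of `L(S)` exactly when the tangent
vector `[S_i Ω_i]` is in the kernel of `C` (`isCertificate_iff`). The gradient `2 C S` vanishes as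
well, so the Hessian form is `2 Tr(Zᵀ C W)`; it is positive semidefinite, and its radical consists
of the horizontal vectors in the kernel of `C` (`forall_hessForm_eq_zero_iff`). Trivial certificates
correspond to vertical vectors, which lie in the kernel of `C`, so that subtracting from a
certificate the mean of its blocks makes it horizontal; this gives the equivalence of
non-degeneracy with the triviality of certificates (`isNondegenerateMin_iff_certificates`).

For rigidity, note that the realization restricts on each view to a rigid copy of its local
coordinates. A perturbation `p` preserving the distances within the views is on each
affinely spanning view an infinitesimal rigid motion, `p_k = Ω_i x_k(S) + t_i`
(`exists_skew_of_view`), and by the description of the kernel of `C` such a family `[-Ω_i]` is a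
certificate; conversely every certificate arises in this way. If all `Ω_i` are equal, then
the `t_i` agree up to the known offsets of the views because `Γ` is connected, so `p` is trivial. If
`p` is trivial, then the `Ω_i` are equal because the views span
(`certificates_iff_isInfinitesimallyRigid`).
-/

namespace RigidAlign

theorem IsMoorePenroseInverse.transpose {ι κ : Type*} [Fintype ι] [Fintype κ]
    {A : Matrix ι κ ℝ} {P : Matrix κ ι ℝ} (h : IsMoorePenroseInverse A P) :
    IsMoorePenroseInverse Aᵀ Pᵀ where
  mul_mul_self := by rw [Matrix.mul_assoc, ← transpose_mul, ← transpose_mul, h.mul_mul_self]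
  mul_mul_inv := by rw [Matrix.mul_assoc, ← transpose_mul, ← transpose_mul, h.mul_mul_inv]
  symm_left := by rw [← transpose_mul, h.symm_right, h.symm_right]
  symm_right := by rw [← transpose_mul, h.symm_left, h.symm_left]

/-! ### Stacks and their blocks -/

section Stack

variable {d m : ℕ}

theorem blk_stack (Z : Fin m → Matrix (Fin d) (Fin d) ℝ) (i : Fin m) : blk (stack Z) i = Z i := rfl

theorem stack_blk (Z : Stack d m) : stack (blk Z) = Z := rfl

theorem Stack.ext_blk {Z W : Stack d m} (h : ∀ i, blk Z i = blk W i) : Z = W := by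
  rw [← stack_blk Z, ← stack_blk W, funext h]

theorem blk_sub (Z W : Stack d m) (i : Fin m) : blk (Z - W) i = blk Z i - blk W i := rfl

theorem blk_mul (Z : Stack d m) (A : Matrix (Fin d) (Fin d) ℝ) (i : Fin m) :
    blk (Z * A) i = blk Z i * A := rfl

theorem blockDiagonal_mul_eq_stack (M : Fin m → Matrix (Fin d) (Fin d) ℝ) (Z : Stack d m) :
    blockDiagonal M * Z = stack fun i => M i * blk Z i := by
  ext ⟨a, i⟩ c
  simp [mul_apply, stack, blk, blockDiagonal_apply, Fintype.sum_prod_type, ite_mul]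

theorem metric_eq_sum (Z W : Stack d m) :
    metric Z W = ∑ i, ((blk Z i)ᵀ * blk W i).trace := by
  simp only [metric, trace, diag, mul_apply, blk, transpose_apply, of_apply,
    Fintype.sum_prod_type_right]
  exact Finset.sum_comm

theorem eq_zero_of_metric_self {Z : Stack d m} (h : metric Z Z = 0) : Z = 0 := by
  have := (trace_conjTranspose_mul_self_eq_zero_iff (A := Z)).1
  rw [conjTranspose_eq_transpose_of_trivial] at this
  exact this h

theorem orthogonal_transpose_mul {A : Matrix (Fin d) (Fin d) ℝ}
    (hA : A ∈ Matrix.orthogonalGroup (Fin d) ℝ) : Aᵀ * A = 1 :=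
  (Matrix.mem_orthogonalGroup_iff' (Fin d) ℝ).1 hA

theorem orthogonal_mul_transpose {A : Matrix (Fin d) (Fin d) ℝ}
    (hA : A ∈ Matrix.orthogonalGroup (Fin d) ℝ) : A * Aᵀ = 1 :=
  (Matrix.mem_orthogonalGroup_iff (Fin d) ℝ).1 hA

/-- The tangent vectors at `S` are the stacks `[S_i Ω_i]` with `Ω_i` skew-symmetric. -/
theorem IsTangent.transpose_mul_skew {S Z : Stack d m} (h : IsTangent S Z) (i : Fin m) :
    ((blk S i)ᵀ * blk Z i)ᵀ = -((blk S i)ᵀ * blk Z i) := by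
  rw [transpose_mul, transpose_transpose, eq_neg_iff_add_eq_zero, add_comm]
  exact h i

theorem isTangent_stack {S : Stack d m} (hS : ∀ i, blk S i ∈ Matrix.orthogonalGroup (Fin d) ℝ)
    {Ω : Fin m → Matrix (Fin d) (Fin d) ℝ} (hΩ : ∀ i, (Ω i)ᵀ = -Ω i) :
    IsTangent S (stack fun i => blk S i * Ω i) := by
  intro i
  rw [blk_stack, transpose_mul, ← Matrix.mul_assoc, Matrix.mul_assoc _ _ (blk S i),
    orthogonal_transpose_mul (hS i), hΩ i]
  simp

theorem trace_skewPart_transpose_mul (M : Matrix (Fin d) (Fin d) ℝ) {A : Matrix (Fin d) (Fin d) ℝ}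
    (hA : Aᵀ = -A) : ((skewPart M)ᵀ * A).trace = (Mᵀ * A).trace := by
  have h : (M * A).trace = -(Mᵀ * A).trace := by
    rw [← trace_transpose, transpose_mul, hA, Matrix.neg_mul, trace_neg, trace_mul_comm]
  rw [skewPart, transpose_smul, transpose_sub, transpose_transpose, Matrix.smul_mul,
    Matrix.sub_mul, trace_smul, trace_sub, h, smul_eq_mul]
  ring

/-- Projecting onto the tangent space does not change the inner product with a tangent vector. -/
theorem metric_tangentProj {S : Stack d m}
    (hS : ∀ i, blk S i ∈ Matrix.orthogonalGroup (Fin d) ℝ)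
    (X : Stack d m) {W : Stack d m} (hW : IsTangent S W) :
    metric (tangentProj S X) W = metric X W := by
  rw [metric_eq_sum, metric_eq_sum]
  refine Finset.sum_congr rfl fun i _ => ?_
  rw [tangentProj, blk_stack, transpose_mul, Matrix.mul_assoc,
    trace_skewPart_transpose_mul _ (hW.transpose_mul_skew i), transpose_mul, transpose_transpose,
    Matrix.mul_assoc, ← Matrix.mul_assoc (blk S i), orthogonal_mul_transpose (hS i), Matrix.one_mul]

end Stack

/-! ### Factorization of the alignment error matrix -/

namespace ViewSystem

variable {d n m : ℕ} (V : ViewSystem d n m)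

/-- The edge-vertex incidence matrix of `Γ`, with rows `e_{ki}ᵀ`. -/
noncomputable def incidence : Matrix V.E (Fin n ⊕ Fin m) ℝ := Matrix.of fun p => edgeVec p.1

/-- The matrix whose row at the edge `(k, i)` is `x_{k,i}ᵀ`, placed in the `i`-th block. -/
noncomputable def coords : Matrix V.E (Fin d × Fin m) ℝ :=
  Matrix.of fun p r => if p.1.2 = r.2 then V.x p.1.1 p.1.2 r.1 else 0

theorem laplacian_eq : V.laplacian = V.incidenceᵀ * V.incidence := by
  ext v w
  simp only [laplacian, Matrix.sum_apply, vecMulVec_apply, mul_apply, incidence,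
    transpose_apply, of_apply]
  exact (Finset.sum_coe_sort V.E fun p => edgeVec p v * edgeVec p w).symm

theorem matB_eq : V.matB = V.coordsᵀ * V.incidence := by
  ext r v
  simp only [matB, mul_apply, incidence, coords, transpose_apply, of_apply, ite_mul, zero_mul,
    Finset.sum_filter]
  exact (Finset.sum_coe_sort V.E fun p =>
    if p.2 = r.2 then V.x p.1 p.2 r.1 * edgeVec p v else 0).symm

theorem matD_eq : V.matD = V.coordsᵀ * V.coords := by
  ext ⟨a, i⟩ ⟨b, j⟩
  simp only [matD, mul_apply, coords, transpose_apply, of_apply, blockDiagonal_apply,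
    Finset.sum_filter]
  rw [Finset.sum_coe_sort V.E fun p => (if p.2 = i then V.x p.1 p.2 a else 0) *
    (if p.2 = j then V.x p.1 p.2 b else 0)]
  split_ifs with h
  · subst h
    rw [Matrix.sum_apply]
    refine Finset.sum_congr rfl fun p _ => ?_
    split_ifs <;> simp [vecMulVec_apply]
  · refine (Finset.sum_eq_zero fun p _ => ?_).symm
    by_cases h1 : p.2 = i
    · have : p.2 ≠ j := fun h2 => h (h1.symm.trans h2)
      simp [this]
    · simp [h1]

theorem laplacianPinv_transpose : V.laplacianPinvᵀ = V.laplacianPinv := by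
  have h := V.laplacianPinv_spec.transpose
  rw [V.laplacian_transpose] at h
  exact h.unique V.laplacianPinv_spec

/-- The residual matrix: `residual * S` lists the errors `S_iᵀ x_{k,i} + t_i - x_k` left by the
optimal translations and consensus points. -/
noncomputable def residual : Matrix V.E (Fin d × Fin m) ℝ :=
  V.coords - V.incidence * V.laplacianPinv * V.matBᵀ

theorem matC_eq : V.matC = V.residualᵀ * V.residual := by
  have h := V.laplacianPinv_spec.mul_mul_inv
  rw [laplacian_eq] at h
  have h' : V.laplacianPinv * (V.incidenceᵀ * (V.incidence * V.laplacianPinv))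
      = V.laplacianPinv := by simpa only [Matrix.mul_assoc] using h
  have h'' (X : Matrix (Fin n ⊕ Fin m) (Fin d × Fin m) ℝ) :
      V.laplacianPinv * (V.incidenceᵀ * (V.incidence * (V.laplacianPinv * X)))
      = V.laplacianPinv * X := by
    rw [← Matrix.mul_assoc V.incidence, ← Matrix.mul_assoc V.incidenceᵀ,
      ← Matrix.mul_assoc V.laplacianPinv, h']
  simp only [matC, matD_eq, matB_eq, residual, transpose_sub, transpose_mul, transpose_transpose,
    laplacianPinv_transpose, Matrix.sub_mul, Matrix.mul_sub, Matrix.mul_assoc, h'']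
  abel

theorem matC_transpose : V.matCᵀ = V.matC := by
  rw [matC_eq, transpose_mul, transpose_transpose]

theorem F_eq (S : Stack d m) : V.F S = ((V.residual * S)ᵀ * (V.residual * S)).trace := by
  rw [F, trace_mul_comm, matC_eq, transpose_mul]
  simp only [Matrix.mul_assoc]

theorem F_nonneg (S : Stack d m) : 0 ≤ V.F S := by
  rw [F_eq]
  have := (posSemidef_conjTranspose_mul_self (V.residual * S)).trace_nonneg
  rwa [conjTranspose_eq_transpose_of_trivial] at this

theorem matC_mul_eq_zero_iff (Z : Stack d m) : V.matC * Z = 0 ↔ V.residual * Z = 0 := by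
  have := conjTranspose_mul_self_mul_eq_zero V.residual Z
  rwa [conjTranspose_eq_transpose_of_trivial, ← matC_eq] at this

theorem F_eq_zero_iff (S : Stack d m) : V.F S = 0 ↔ V.matC * S = 0 := by
  rw [matC_mul_eq_zero_iff, F_eq, ← conjTranspose_eq_transpose_of_trivial,
    trace_conjTranspose_mul_self_eq_zero_iff]

/-- The row space of the incidence matrix is the range of the Laplacian, on which `L_Γ^† L_Γ` is the
identity. -/
theorem incidence_mul_pinv_mul_laplacian :
    V.incidence * (V.laplacianPinv * V.laplacian) = V.incidence := by
  have h : V.laplacian * (1 - V.laplacianPinv * V.laplacian) = 0 := by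
    rw [Matrix.mul_sub, Matrix.mul_one, ← Matrix.mul_assoc, V.laplacianPinv_spec.mul_mul_self,
      sub_self]
  have h2 := conjTranspose_mul_self_mul_eq_zero V.incidence (1 - V.laplacianPinv * V.laplacian)
  rw [conjTranspose_eq_transpose_of_trivial, ← laplacian_eq] at h2
  have h3 := h2.1 h
  rw [Matrix.mul_sub, Matrix.mul_one, sub_eq_zero] at h3
  exact h3.symm

theorem coords_mul_apply (Z : Stack d m) (p : V.E) :
    (V.coords * Z) p = (blk Z p.1.2)ᵀ *ᵥ V.x p.1.1 p.1.2 := by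
  ext a
  simp [mul_apply, coords, mulVec, dotProduct, blk, Fintype.sum_prod_type, mul_comm]

theorem incidence_mul_apply {κ : Type*} (Y : Matrix (Fin n ⊕ Fin m) κ ℝ) (p : V.E) :
    (V.incidence * Y) p = Y (Sum.inl p.1.1) - Y (Sum.inr p.1.2) := by
  ext a
  simp [mul_apply, incidence, edgeVec, sub_mul, Pi.single_apply, ite_mul]

/-- `C Z = 0` exactly when the vectors `Z_iᵀ x_{k,i}` agree, up to a translation `t_i` of each view,
with a single configuration `y_k` of the points. -/
theorem matC_mul_eq_zero_iff_exists (Z : Stack d m) :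
    V.matC * Z = 0 ↔ ∃ (y : Fin n → Fin d → ℝ) (t : Fin m → Fin d → ℝ),
      ∀ k i, (k, i) ∈ V.E → (blk Z i)ᵀ *ᵥ V.x k i = y k - t i := by
  rw [matC_mul_eq_zero_iff]
  constructor
  · intro h
    rw [residual, Matrix.sub_mul, sub_eq_zero, Matrix.mul_assoc, Matrix.mul_assoc] at h
    refine ⟨fun k => (V.laplacianPinv * (V.matBᵀ * Z)) (Sum.inl k),
      fun i => (V.laplacianPinv * (V.matBᵀ * Z)) (Sum.inr i), fun k i hki => ?_⟩
    have := congrFun h ⟨(k, i), hki⟩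
    rwa [coords_mul_apply, incidence_mul_apply] at this
  · rintro ⟨y, t, h⟩
    have hK : V.coords * Z = V.incidence * (Matrix.of (Sum.elim y t)) := by
      funext p
      rw [coords_mul_apply, incidence_mul_apply]
      exact h _ _ p.2
    rw [residual, Matrix.sub_mul, sub_eq_zero, matB_eq, transpose_mul, transpose_transpose,
      Matrix.mul_assoc, Matrix.mul_assoc V.incidenceᵀ, hK, ← Matrix.mul_assoc V.incidenceᵀ,
      ← laplacian_eq, Matrix.mul_assoc V.incidence, ← Matrix.mul_assoc V.laplacianPinv,
      ← Matrix.mul_assoc V.incidence, incidence_mul_pinv_mul_laplacian]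

/-- In the definition of `realization` the product by the centering matrix is elaborated through the
multiplication of `CStarMatrix`; it is definitionally the usual matrix product used here. -/
theorem realization_eq (S : Stack d m) :
    V.realization S =
      ((Sᵀ * V.matB * V.laplacianPinv).submatrix id Sum.inl : Matrix (Fin d) (Fin n) ℝ) *
        ((1 - (n : ℝ)⁻¹ • Matrix.of fun _ _ => (1 : ℝ)) : Matrix (Fin n) (Fin n) ℝ) :=
  rfl

/-- At a perfect alignment, the realization restricts on each view to a rigid copy of its local
coordinates. -/
theorem exists_realization_eq {S : Stack d m} (hS : V.matC * S = 0) :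
    ∃ τ : Fin m → Fin d → ℝ, ∀ k i, (k, i) ∈ V.E →
      (V.realization S).col k = (blk S i)ᵀ *ᵥ V.x k i + τ i := by
  rw [matC_mul_eq_zero_iff, residual, Matrix.sub_mul, sub_eq_zero, Matrix.mul_assoc,
    Matrix.mul_assoc] at hS
  set Y := V.laplacianPinv * (V.matBᵀ * S) with hY
  have hYt : Sᵀ * V.matB * V.laplacianPinv = Yᵀ := by
    rw [hY, transpose_mul, transpose_mul, transpose_transpose, laplacianPinv_transpose]
  refine ⟨fun i => Y (Sum.inr i) - fun a => (n : ℝ)⁻¹ * ∑ l, Y (Sum.inl l) a, fun k i hki => ?_⟩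
  have h := congrFun hS ⟨(k, i), hki⟩
  rw [coords_mul_apply, incidence_mul_apply] at h
  simp only at h
  rw [h]
  ext a
  have h2 : V.realization S a k = Y (Sum.inl k) a - (n : ℝ)⁻¹ * ∑ l, Y (Sum.inl l) a := by
    rw [realization_eq, hYt, Matrix.mul_sub, Matrix.mul_one, Matrix.mul_smul]
    simp [mul_apply]
  rw [Matrix.col_apply, h2]
  simp only [Pi.add_apply, Pi.sub_apply]
  ring

/-! ### The Riemannian Hessian at a perfect alignment -/

theorem euclideanGrad_eq (S : Stack d m) : V.euclideanGrad S = (2 : ℝ) • (V.matC * S) := by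
  ext r c
  have htr (A : Stack d m) : (V.matC * A * (single r c (1 : ℝ))ᵀ).trace = (V.matC * A) r c := by
    simp [transpose_single, trace_mul_single]
  have hF (t : ℝ) : V.F (S + t • single r c 1) = V.F S + t * (2 * (V.matC * S) r c) +
      t ^ 2 * V.F (single r c 1) := by
    have h2 : (V.matC * single r c (1 : ℝ) * Sᵀ).trace = (V.matC * S) r c := by
      rw [← htr, ← trace_transpose, transpose_mul, transpose_mul, transpose_transpose,
        matC_transpose, trace_mul_comm, Matrix.mul_assoc, trace_mul_comm, Matrix.mul_assoc,
        trace_mul_comm, Matrix.mul_assoc]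
    simp only [F, Matrix.mul_add, Matrix.add_mul, transpose_add, transpose_smul, Matrix.mul_smul,
      Matrix.smul_mul, trace_add, trace_smul, smul_eq_mul, h2, htr]
    ring
  have hd : HasDerivAt (fun t : ℝ => V.F S + t * (2 * (V.matC * S) r c) +
      t ^ 2 * V.F (single r c 1)) (2 * (V.matC * S) r c) 0 := by
    have h1 := ((hasDerivAt_id (0 : ℝ)).mul_const (2 * (V.matC * S) r c)).const_add (V.F S)
    have h2 := (hasDerivAt_pow 2 (0 : ℝ)).mul_const (V.F (single r c 1))
    refine (h1.add h2).congr_deriv ?_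
    norm_num
  simp only [euclideanGrad, of_apply, hF, Matrix.smul_apply, smul_eq_mul]
  exact hd.deriv

/-- The product rule at a zero of the first factor needs only continuity of the second. -/
theorem hasDerivAt_mul_self {g : ℝ → ℝ} (hg : Continuous g) :
    HasDerivAt (fun t => t * g t) (g 0) 0 := by
  rw [hasDerivAt_iff_tendsto_slope]
  refine Filter.Tendsto.congr' ?_ (hg.continuousAt.tendsto.mono_left nhdsWithin_le_nhds)
  filter_upwards [self_mem_nhdsWithin] with t ht
  have : t ≠ 0 := ht
  simp [slope_def_field, this]

/-- As `grad F` vanishes along with `C S`, only the derivative of `∇F = 2 C S` survives. -/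
theorem derivRiemannianGrad_eq {S : Stack d m} (hS : V.matC * S = 0) (Z : Stack d m) :
    V.derivRiemannianGrad S Z = tangentProj S ((2 : ℝ) • (V.matC * Z)) := by
  ext ⟨a, i⟩ c
  have key (t : ℝ) : V.riemannianGrad (S + t • Z) (a, i) c =
      t * ((blk S i + t • blk Z i) * skewPart ((blk S i + t • blk Z i)ᵀ *
        blk ((2 : ℝ) • (V.matC * Z)) i)) a c := by
    have h1 : V.euclideanGrad (S + t • Z) = t • ((2 : ℝ) • (V.matC * Z)) := by
      rw [euclideanGrad_eq, Matrix.mul_add, hS, zero_add, Matrix.mul_smul, smul_comm]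
    have h2 : blk (S + t • Z) i = blk S i + t • blk Z i := rfl
    have h3 (X : Stack d m) : blk (t • X) i = t • blk X i := rfl
    have h4 (A : Matrix (Fin d) (Fin d) ℝ) : skewPart (t • A) = t • skewPart A := by
      rw [skewPart, skewPart, transpose_smul, ← smul_sub, smul_comm]
    calc V.riemannianGrad (S + t • Z) (a, i) c
        = (blk (S + t • Z) i * skewPart ((blk (S + t • Z) i)ᵀ *
          blk (V.euclideanGrad (S + t • Z)) i)) a c := rfl
      _ = _ := by rw [h1, h2, h3, Matrix.mul_smul, h4, Matrix.mul_smul, Matrix.smul_apply,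
            smul_eq_mul]
  simp only [derivRiemannianGrad, of_apply, key]
  have hc : Continuous fun t : ℝ => ((blk S i + t • blk Z i) * skewPart ((blk S i + t • blk Z i)ᵀ *
        blk ((2 : ℝ) • (V.matC * Z)) i)) a c := by
    unfold skewPart
    fun_prop
  rw [(hasDerivAt_mul_self hc).deriv, zero_smul, add_zero]
  rfl

theorem hessForm_eq {S : Stack d m} (hO : ∀ i, blk S i ∈ Matrix.orthogonalGroup (Fin d) ℝ)
    (hS : V.matC * S = 0) (Z : Stack d m) {W : Stack d m} (hW : IsTangent S W) :
    V.hessForm S Z W = 2 * metric (V.matC * Z) W := by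
  rw [hessForm, derivRiemannianGrad_eq V hS, metric_tangentProj hO _ hW]
  simp [metric]

theorem metric_matC_mul_self (Z : Stack d m) : metric (V.matC * Z) Z = V.F Z := by
  rw [metric, transpose_mul, matC_transpose, F, Matrix.mul_assoc, trace_mul_comm, Matrix.mul_assoc]

/-- The Hessian form at a perfect alignment is `2 Tr(Zᵀ C W)`, which is positive semidefinite, so its
radical is the horizontal part of the kernel of `C`. -/
theorem forall_hessForm_eq_zero_iff {S : Stack d m}
    (hO : ∀ i, blk S i ∈ Matrix.orthogonalGroup (Fin d) ℝ)
    (hS : V.matC * S = 0) {Z : Stack d m} (hZ : IsHorizontal S Z) :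
    (∀ W, IsHorizontal S W → V.hessForm S Z W = 0) ↔ V.matC * Z = 0 := by
  constructor
  · intro h
    have h1 := h Z hZ
    rw [hessForm_eq V hO hS Z hZ.1, metric_matC_mul_self] at h1
    rw [← F_eq_zero_iff]
    linarith
  · intro h W hW
    rw [hessForm_eq V hO hS Z hW.1, h]
    simp [metric]

theorem isNondegenerateMin_iff {S : OrthStack d m} (hS : V.IsPerfectAlignment S) :
    V.IsNondegenerateMin (proj S) ↔ ∀ Q ∈ Matrix.orthogonalGroup (Fin d) ℝ,
      ∀ Z, IsHorizontal (S.1 * Q) Z → V.matC * Z = 0 → Z = 0 := by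
  have hCS : V.matC * S.1 = 0 := (V.F_eq_zero_iff S.1).1 hS
  have hCQ (Q : Matrix (Fin d) (Fin d) ℝ) : V.matC * (S.1 * Q) = 0 := by
    rw [← Matrix.mul_assoc, hCS, Matrix.zero_mul]
  have hOQ {Q : Matrix (Fin d) (Fin d) ℝ} (hQ : Q ∈ Matrix.orthogonalGroup (Fin d) ℝ) (i : Fin m) :
      blk (S.1 * Q) i ∈ Matrix.orthogonalGroup (Fin d) ℝ := mul_mem (S.2 i) hQ
  constructor
  · rintro ⟨-, h⟩ Q hQ Z hZ hCZ
    refine h ⟨S.1 * Q, hOQ hQ⟩ (Quotient.sound ?_) Z hZ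
      ((V.forall_hessForm_eq_zero_iff (hOQ hQ) (hCQ Q) hZ).2 hCZ)
    exact (orthSetoid d m).symm ⟨Q, hQ, rfl⟩
  · intro h
    refine ⟨fun q' => ?_, fun T hT Z hZ hW => ?_⟩
    · obtain ⟨T, rfl⟩ := Quotient.exists_rep q'
      calc V.Ftilde (proj S) = 0 := hS
        _ ≤ V.F T.1 := V.F_nonneg T.1
    · obtain ⟨Q, hQ, hTQ⟩ : ∃ Q ∈ Matrix.orthogonalGroup (Fin d) ℝ, T.1 = S.1 * Q :=
        (orthSetoid d m).symm (Quotient.exact hT)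
      have hO := T.2
      rw [hTQ] at hZ hW hO
      exact h Q hQ Z hZ ((V.forall_hessForm_eq_zero_iff hO (hCQ Q) hZ).1 hW)

/-! ### Certificates at a perfect alignment -/

/-- At a perfect alignment `L(S) = C(S)`, so the certificates of `L(S)` are the tangent vectors at `S`
in the kernel of `C`. -/
theorem isCertificate_iff {S : Stack d m} (hO : ∀ i, blk S i ∈ Matrix.orthogonalGroup (Fin d) ℝ)
    (hS : V.matC * S = 0) (Ω : Stack d m) :
    V.IsCertificate S Ω ↔ (∀ i, (blk Ω i)ᵀ = -blk Ω i) ∧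
      V.matC * (stack fun i => blk S i * blk Ω i) = 0 := by
  have hhat : V.matCHat S = 0 := by
    have (i : Fin m) : (blk S i)ᵀ * blk (V.matC * S) i = 0 := by
      rw [hS]
      exact Matrix.mul_zero _
    simp only [matCHat, this]
    exact blockDiagonal_zero
  have hL : V.matL S * Ω = blockDiagonal (fun i => (blk S i)ᵀ) *
      (V.matC * (stack fun i => blk S i * blk Ω i)) := by
    rw [matL, hhat, sub_zero, matCS, Matrix.mul_assoc, Matrix.mul_assoc,
      blockDiagonal_mul_eq_stack (fun i => blk S i)]
  rw [IsCertificate, hL]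
  refine and_congr_right fun _ => ⟨fun h => ?_, fun h => by rw [h, Matrix.mul_zero]⟩
  have h1 : blockDiagonal (fun i => blk S i) * blockDiagonal (fun i => (blk S i)ᵀ) = 1 := by
    rw [← blockDiagonal_mul, ← blockDiagonal_one]
    congr 1
    funext i
    exact orthogonal_mul_transpose (hO i)
  rw [← Matrix.one_mul (V.matC * _), ← h1, Matrix.mul_assoc, h, Matrix.mul_zero]

theorem isNondegenerateMin_iff_certificates {S : OrthStack d m} (hS : V.IsPerfectAlignment S) :
    V.IsNondegenerateMin (proj S) ↔ V.HasOnlyTrivialCertificates S.1 := by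
  have hCS : V.matC * S.1 = 0 := (V.F_eq_zero_iff S.1).1 hS
  rw [isNondegenerateMin_iff V hS]
  constructor
  · intro h Ω hΩ i j
    obtain ⟨hskew, hker⟩ := (V.isCertificate_iff S.2 hCS Ω).1 hΩ
    have hm : (m : ℝ) ≠ 0 := Nat.cast_ne_zero.2 (Fin.pos i).ne'
    -- Subtracting the mean of the blocks makes the certificate horizontal.
    set M : Matrix (Fin d) (Fin d) ℝ := (m : ℝ)⁻¹ • ∑ i, blk Ω i with hM
    have hMskew : Mᵀ = -M := by
      simp only [hM, transpose_smul, transpose_sum, hskew, Finset.sum_neg_distrib, smul_neg]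
    set Z : Stack d m := stack fun i => blk S.1 i * (blk Ω i - M) with hZ
    have hZeq : Z = (stack fun i => blk S.1 i * blk Ω i) - S.1 * M := by
      refine Stack.ext_blk fun i => ?_
      rw [blk_sub, blk_mul, hZ, blk_stack, blk_stack, Matrix.mul_sub]
    have hCZ : V.matC * Z = 0 := by
      rw [hZeq, Matrix.mul_sub, hker, ← Matrix.mul_assoc, hCS, Matrix.zero_mul, sub_zero]
    have hhor : IsHorizontal S.1 Z := by
      refine ⟨isTangent_stack S.2 fun i => ?_, fun A _ => ?_⟩
      · rw [transpose_sub, hskew, hMskew]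
        abel
      · have (i : Fin m) : (blk (S.1 * A) i)ᵀ * blk Z i = Aᵀ * (blk Ω i - M) := by
          rw [blk_mul, hZ, blk_stack, transpose_mul, Matrix.mul_assoc,
            ← Matrix.mul_assoc (blk S.1 i)ᵀ, orthogonal_transpose_mul (S.2 i), Matrix.one_mul]
        rw [metric_eq_sum]
        simp only [this]
        rw [← trace_sum, ← Matrix.mul_sum, Finset.sum_sub_distrib, Finset.sum_const,
          Finset.card_univ, Fintype.card_fin, ← Nat.cast_smul_eq_nsmul ℝ, hM,
          smul_inv_smul₀ hm, sub_self, Matrix.mul_zero, trace_zero]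
    have hZ0 := h 1 (one_mem _) Z (by rwa [Matrix.mul_one]) hCZ
    have hblk (i : Fin m) : blk Ω i = M := by
      have h1 : blk S.1 i * (blk Ω i - M) = 0 := by
        rw [← blk_stack (fun i => blk S.1 i * (blk Ω i - M)) i, ← hZ, hZ0]
        rfl
      rw [← sub_eq_zero, ← Matrix.one_mul (blk Ω i - M), ← orthogonal_transpose_mul (S.2 i),
        Matrix.mul_assoc, h1, Matrix.mul_zero]
    rw [hblk i, hblk j]
  · intro h Q hQ Z hZ hCZ
    -- Undoing the rotation `Q` turns a horizontal vector at `S Q` into a certificate of `L(S)`.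
    set Ω : Stack d m := stack fun i => (blk S.1 i)ᵀ * blk Z i * Qᵀ with hΩ
    have hQ1 := orthogonal_mul_transpose hQ
    have hQ2 := orthogonal_transpose_mul hQ
    have hΩZ : (stack fun i => blk S.1 i * blk Ω i) = Z * Qᵀ := by
      refine Stack.ext_blk fun i => ?_
      rw [blk_stack, hΩ, blk_stack, blk_mul, ← Matrix.mul_assoc, ← Matrix.mul_assoc,
        orthogonal_mul_transpose (S.2 i), Matrix.one_mul]
    have hcert : V.IsCertificate S.1 Ω := by
      refine (V.isCertificate_iff S.2 hCS Ω).2 ⟨fun i => ?_, ?_⟩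
      · have h1 := hZ.1.transpose_mul_skew i
        have h2 : blk Ω i = Q * ((blk (S.1 * Q) i)ᵀ * blk Z i) * Qᵀ := by
          rw [hΩ, blk_stack, blk_mul, transpose_mul, Matrix.mul_assoc Qᵀ, ← Matrix.mul_assoc Q, hQ1,
            Matrix.one_mul]
        rw [h2, transpose_mul, transpose_mul, h1, transpose_transpose]
        simp only [Matrix.mul_assoc, Matrix.neg_mul, Matrix.mul_neg]
      · rw [hΩZ, ← Matrix.mul_assoc, hCZ, Matrix.zero_mul]
    rcases isEmpty_or_nonempty (Fin m) with hm | ⟨⟨i₀⟩⟩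
    · ext ⟨_, i⟩
      exact (hm.false i).elim
    · -- `Z` is vertical, hence orthogonal to itself.
      have hvert : Z = S.1 * Q * (Qᵀ * blk Ω i₀ * Q) := by
        have h1 : (stack fun i => blk S.1 i * blk Ω i) = S.1 * blk Ω i₀ :=
          Stack.ext_blk fun i => by rw [blk_stack, blk_mul, h Ω hcert i i₀]
        calc Z = Z * Qᵀ * Q := by rw [Matrix.mul_assoc, hQ2, Matrix.mul_one]
          _ = S.1 * (Q * Qᵀ) * blk Ω i₀ * Q := by rw [← hΩZ, h1, hQ1, Matrix.mul_one]
          _ = _ := by simp only [Matrix.mul_assoc]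
      refine eq_zero_of_metric_self ?_
      have h2 := hZ.2 (Qᵀ * blk Ω i₀ * Q) (by
        rw [transpose_mul, transpose_mul, hcert.1 i₀, transpose_transpose]
        simp only [Matrix.mul_assoc, Matrix.neg_mul, Matrix.mul_neg])
      rwa [← hvert] at h2

end ViewSystem

/-! ### Infinitesimal isometries of a spanning configuration -/

/-- An infinitesimal isometry of a family that spans `ℝ^d` is the restriction of an infinitesimal
rotation. -/
theorem exists_skew_mulVec_eq {d : ℕ} {ι : Type*} (y q : ι → Fin d → ℝ)
    (hy : Submodule.span ℝ (Set.range y) = ⊤)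
    (hq : ∀ k l, q k ⬝ᵥ y l = -(y k ⬝ᵥ q l)) :
    ∃ A : Matrix (Fin d) (Fin d) ℝ, Aᵀ = -A ∧ ∀ k, q k = A *ᵥ y k := by
  set T := Finsupp.linearCombination ℝ y with hT
  set R := Finsupp.linearCombination ℝ q with hR
  have hTsurj : LinearMap.range T = ⊤ := by rw [hT, Finsupp.range_linearCombination, hy]
  have hTR (c c' : ι →₀ ℝ) : R c ⬝ᵥ T c' = -(T c ⬝ᵥ R c') := by
    simp only [hT, hR, Finsupp.linearCombination_apply, Finsupp.sum, sum_dotProduct,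
      dotProduct_sum, smul_dotProduct, dotProduct_smul, hq, smul_neg, Finset.sum_neg_distrib]
  -- `R` factors through the surjection `T`; the factor is `R ∘ s` for any section `s` of `T`.
  obtain ⟨s, hs⟩ := T.exists_rightInverse_of_surjective hTsurj
  have hs' (v : Fin d → ℝ) : T (s v) = v := LinearMap.congr_fun hs v
  refine ⟨LinearMap.toMatrix' (R ∘ₗ s), ?_, fun k => ?_⟩
  · ext a b
    have h := hTR (s (Pi.single a 1)) (s (Pi.single b 1))
    rw [hs', hs', dotProduct_single_one, single_one_dotProduct] at h
    simp only [transpose_apply, Matrix.neg_apply, LinearMap.toMatrix'_apply, LinearMap.comp_apply]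
    exact h
  · rw [LinearMap.toMatrix'_mulVec, LinearMap.comp_apply, ← sub_eq_zero]
    have h0 : T (Finsupp.single k 1 - s (y k)) = 0 := by
      rw [map_sub, hs', hT, Finsupp.linearCombination_single, one_smul, sub_self]
    have h1 : R (Finsupp.single k 1 - s (y k)) = q k - R (s (y k)) := by
      rw [map_sub, hR, Finsupp.linearCombination_single, one_smul]
    rw [← h1]
    refine dotProduct_eq_zero _ fun w => ?_
    rw [← hs' w, hTR, h0, zero_dotProduct, neg_zero]

namespace ViewSystem

variable {d n m : ℕ} (V : ViewSystem d n m)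

theorem exists_mem_view (hview : V.AffinelyNondegenerate) (i : Fin m) : ∃ k, (k, i) ∈ V.E := by
  by_contra! h
  have h0 : V.viewPoints i = ∅ := Set.eq_empty_of_forall_notMem fun _ ⟨k, hk, _⟩ => h k hk
  have := hview i
  rw [h0, AffineSubspace.span_empty] at this
  exact AffineSubspace.bot_ne_top ℝ _ _ this

theorem span_view_sub_eq_top (hview : V.AffinelyNondegenerate) {k₀ : Fin n} {i : Fin m}
    (hk₀ : (k₀, i) ∈ V.E) :
    Submodule.span ℝ (Set.range fun k : {k // (k, i) ∈ V.E} => V.x k i - V.x k₀ i) = ⊤ := by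
  have h1 : (affineSpan ℝ (V.viewPoints i)).direction = ⊤ := by
    rw [hview i, AffineSubspace.direction_top]
  rw [direction_affineSpan, vectorSpan_eq_span_vsub_set_right ℝ
    (show V.x k₀ i ∈ V.viewPoints i from ⟨k₀, hk₀, rfl⟩)] at h1
  rw [← h1]
  congr 1
  ext v
  constructor
  · rintro ⟨k, rfl⟩
    exact ⟨V.x k i, ⟨k, k.2, rfl⟩, rfl⟩
  · rintro ⟨_, ⟨k, hk, rfl⟩, rfl⟩
    exact ⟨⟨k, hk⟩, rfl⟩

/-- A potential on the vertices of `Γ` that agrees along every edge is constant. -/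
theorem exists_eq_of_connected {α : Type*} (hconn : V.graph.Connected) (f : Fin n → α)
    (t : Fin m → α) (h : ∀ k i, (k, i) ∈ V.E → f k = t i) :
    ∃ c, (∀ k, f k = c) ∧ ∀ i, t i = c := by
  have hadj (v w : Fin n ⊕ Fin m) (hvw : V.graph.Adj v w) :
      Sum.elim f t v = Sum.elim f t w := by
    rw [graph, SimpleGraph.fromRel_adj] at hvw
    obtain ⟨-, ⟨k, i, hki, rfl, rfl⟩ | ⟨k, i, hki, rfl, rfl⟩⟩ := hvw
    · exact h k i hki
    · exact (h k i hki).symm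
  have hwalk (v w : Fin n ⊕ Fin m) (p : V.graph.Walk v w) :
      Sum.elim f t v = Sum.elim f t w := by
    induction p with
    | nil => rfl
    | cons hvw _ ih => exact (hadj _ _ hvw).trans ih
  obtain ⟨v₀⟩ := hconn.nonempty
  have hall (v : Fin n ⊕ Fin m) : Sum.elim f t v = Sum.elim f t v₀ :=
    (hconn.preconnected v v₀).elim (hwalk v v₀)
  exact ⟨_, fun k => hall (Sum.inl k), fun i => hall (Sum.inr i)⟩

/-- A perturbation preserving the distances within the `i`-th view is an infinitesimal rigid motion
of that view. -/
theorem exists_skew_of_view (hview : V.AffinelyNondegenerate) {A : Matrix (Fin d) (Fin d) ℝ}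
    (hA : A ∈ Matrix.orthogonalGroup (Fin d) ℝ) (i : Fin m) (p : Fin n → Fin d → ℝ)
    (hp : ∀ k₁ k₂, (k₁, i) ∈ V.E → (k₂, i) ∈ V.E →
      (p k₁ - p k₂) ⬝ᵥ (Aᵀ *ᵥ (V.x k₁ i - V.x k₂ i)) = 0) :
    ∃ (Ω : Matrix (Fin d) (Fin d) ℝ) (t : Fin d → ℝ), Ωᵀ = -Ω ∧
      ∀ k, (k, i) ∈ V.E → p k = Ω *ᵥ (Aᵀ *ᵥ V.x k i) + t := by
  obtain ⟨k₀, hk₀⟩ := V.exists_mem_view hview i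
  have hp' (k₁ k₂) (h₁ : (k₁, i) ∈ V.E) (h₂ : (k₂, i) ∈ V.E) :
      (A *ᵥ (p k₁ - p k₂)) ⬝ᵥ (V.x k₁ i - V.x k₂ i) = 0 := by
    rw [← hp k₁ k₂ h₁ h₂, dotProduct_mulVec, vecMul_transpose]
  obtain ⟨Ω, hΩ, h⟩ := exists_skew_mulVec_eq
    (fun k : {k // (k, i) ∈ V.E} => V.x k i - V.x k₀ i)
    (fun k : {k // (k, i) ∈ V.E} => A *ᵥ (p k - p k₀)) (V.span_view_sub_eq_top hview hk₀) (by
      -- Polarization of `hp'`.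
      rintro ⟨k, hk⟩ ⟨l, hl⟩
      have h1 := hp' k k₀ hk hk₀
      have h2 := hp' l k₀ hl hk₀
      have h3 := hp' k l hk hl
      rw [dotProduct_comm (V.x k i - _)]
      simp only [mulVec_sub, sub_dotProduct, dotProduct_sub] at h1 h2 h3 ⊢
      linarith)
  have hAΩ : (Aᵀ * Ω * A)ᵀ = -(Aᵀ * Ω * A) := by
    rw [transpose_mul, transpose_mul, hΩ, transpose_transpose]
    simp only [Matrix.mul_assoc, Matrix.neg_mul, Matrix.mul_neg]
  refine ⟨Aᵀ * Ω * A, p k₀ - (Aᵀ * Ω * A) *ᵥ (Aᵀ *ᵥ V.x k₀ i), hAΩ, fun k hk => ?_⟩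
  have h1 : Aᵀ *ᵥ (A *ᵥ (p k - p k₀)) = Aᵀ *ᵥ (Ω *ᵥ (V.x k i - V.x k₀ i)) :=
    congrArg _ (h ⟨k, hk⟩)
  rw [mulVec_mulVec, orthogonal_transpose_mul hA, one_mulVec] at h1
  have h2 (v : Fin d → ℝ) : (Aᵀ * Ω * A) *ᵥ (Aᵀ *ᵥ v) = Aᵀ *ᵥ (Ω *ᵥ v) := by
    rw [mulVec_mulVec, Matrix.mul_assoc, orthogonal_mul_transpose hA, Matrix.mul_one,
      mulVec_mulVec]
  rw [h2, h2, ← sub_add_cancel (p k) (p k₀), h1, mulVec_sub, mulVec_sub]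
  abel

/-- A certificate `Ω` and the perturbation `p` of the realization which rotates the `i`-th view with
angular velocity `-Ω_i` determine each other. -/
theorem certificates_iff_isInfinitesimallyRigid (hconn : V.graph.Connected)
    (hview : V.AffinelyNondegenerate) {S : Stack d m}
    (hO : ∀ i, blk S i ∈ Matrix.orthogonalGroup (Fin d) ℝ) (hS : V.matC * S = 0) :
    V.HasOnlyTrivialCertificates S ↔ V.IsInfinitesimallyRigid (V.realization S) := by
  obtain ⟨τ, hτ⟩ := V.exists_realization_eq hS
  have hdiff {k₁ k₂ i} (h₁ : (k₁, i) ∈ V.E) (h₂ : (k₂, i) ∈ V.E) :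
      (V.realization S).col k₁ - (V.realization S).col k₂ =
        (blk S i)ᵀ *ᵥ (V.x k₁ i - V.x k₂ i) := by
    rw [hτ _ _ h₁, hτ _ _ h₂, mulVec_sub]
    abel
  constructor
  · intro h p hp
    choose Ω t hΩ hpt using fun i => V.exists_skew_of_view hview (hO i) i p
      fun k₁ k₂ h₁ h₂ => by rw [← hdiff h₁ h₂, hp k₁ k₂ i h₁ h₂]
    have hcert : V.IsCertificate S (stack fun i => -Ω i) := by
      refine (V.isCertificate_iff hO hS _).2 ⟨fun i => ?_, ?_⟩
      · rw [blk_stack, transpose_neg, hΩ]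
      · refine (V.matC_mul_eq_zero_iff_exists _).2 ⟨p, t, fun k i hki => ?_⟩
        rw [blk_stack, blk_stack, transpose_mul, transpose_neg, hΩ, neg_neg, ← mulVec_mulVec,
          hpt i k hki, add_sub_cancel_right]
    have hcst (i j : Fin m) : Ω i = Ω j := neg_injective (h _ hcert i j)
    obtain ⟨A, hA, hAΩ⟩ : ∃ A : Matrix (Fin d) (Fin d) ℝ, Aᵀ = -A ∧ ∀ i, Ω i = A := by
      rcases isEmpty_or_nonempty (Fin m) with hm | ⟨⟨i₀⟩⟩
      · exact ⟨0, by simp, fun i => (hm.false i).elim⟩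
      · exact ⟨Ω i₀, hΩ i₀, fun i => hcst i i₀⟩
    -- The remaining translations of the views agree by connectedness.
    obtain ⟨c, hc, -⟩ := V.exists_eq_of_connected hconn
      (fun k => p k - A *ᵥ (V.realization S).col k) (fun i => t i - A *ᵥ τ i) fun k i hki => by
        rw [hpt i k hki, hτ k i hki, hAΩ i, mulVec_add]
        abel
    exact ⟨A, c, hA, fun k => by rw [← hc k, add_sub_cancel]⟩
  · intro h Ω hΩ
    obtain ⟨hskew, hker⟩ := (V.isCertificate_iff hO hS Ω).1 hΩ
    obtain ⟨p, t, hpt⟩ := (V.matC_mul_eq_zero_iff_exists _).1 hker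
    have hp {k₁ k₂ i} (h₁ : (k₁, i) ∈ V.E) (h₂ : (k₂, i) ∈ V.E) :
        p k₁ - p k₂ = -(blk Ω i *ᵥ ((V.realization S).col k₁ - (V.realization S).col k₂)) := by
      have e₁ := hpt _ _ h₁
      have e₂ := hpt _ _ h₂
      rw [blk_stack, transpose_mul, hskew, ← mulVec_mulVec, neg_mulVec] at e₁ e₂
      rw [hdiff h₁ h₂, mulVec_sub, mulVec_sub, neg_sub, ← sub_sub_sub_cancel_right _ _ (t i),
        ← e₁, ← e₂]
      abel
    obtain ⟨A, c, hA, hpA⟩ := h p fun k₁ k₂ i h₁ h₂ => by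
      rw [hp h₁ h₂]
      set v := (V.realization S).col k₁ - (V.realization S).col k₂
      have h1 : (blk Ω i *ᵥ v) ⬝ᵥ v = -((blk Ω i *ᵥ v) ⬝ᵥ v) := by
        conv_lhs => rw [dotProduct_comm, dotProduct_mulVec, ← mulVec_transpose, hskew, neg_mulVec,
          neg_dotProduct]
      rw [neg_dotProduct]
      linarith
    have hΩA (i : Fin m) : blk Ω i = -A := by
      obtain ⟨k₀, hk₀⟩ := V.exists_mem_view hview i
      have h0 : (blk Ω i + A) * (blk S i)ᵀ = 0 := by
        refine (toLin' (R := ℝ)).injective ?_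
        rw [map_zero]
        refine LinearMap.ext_on_range (V.span_view_sub_eq_top hview hk₀) fun ⟨k, hk⟩ => ?_
        rw [toLin'_apply, ← mulVec_mulVec, ← hdiff hk hk₀, add_mulVec, LinearMap.zero_apply,
          add_comm, ← eq_neg_iff_add_eq_zero, ← hp hk hk₀, hpA, hpA, mulVec_sub]
        abel
      rw [← add_eq_zero_iff_eq_neg, ← Matrix.mul_one (blk Ω i + A),
        ← orthogonal_transpose_mul (hO i), ← Matrix.mul_assoc, h0, Matrix.zero_mul]
    intro i j
    rw [hΩA i, hΩA j]

end ViewSystem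

end RigidAlign

theorem mainTheorem2 {d n m : ℕ} (V : RigidAlign.ViewSystem d n m)
    (hconn : V.graph.Connected) (hview : V.AffinelyNondegenerate)
    (S : RigidAlign.OrthStack d m) (hS : V.IsPerfectAlignment S) :
    (V.IsNondegenerateMin (RigidAlign.proj S) ↔ V.HasOnlyTrivialCertificates S.1) ∧
    (V.IsNondegenerateMin (RigidAlign.proj S) ↔
      V.IsInfinitesimallyRigid (V.realization S.1)) := by
  have h := V.isNondegenerateMin_iff_certificates hS
  exact ⟨h, h.trans (V.certificates_iff_isInfinitesimallyRigid hconn hview S.2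
    ((V.F_eq_zero_iff S.1).1 hS))⟩
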